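/- **Setting.** Let $T>0$ and let $W$ be a $d$-dimensional Wiener process on a probability space with its augmented filtration. Let $\mu:\mathbb R_+\times\mathbb R^n\times\mathbb R^k\to\mathbb R^n$, $\sigma:\mathbb R_+\times\mathbb R^n\times\mathbb R^k\to M(n,d)$ and $U:\mathbb R_+\times\mathbb R^n\to 2^{\mathbb R^k}$ be given, together with real-valued functions $H(t,x,s,y,u)$, $F(t,x,y)$ and $G(t,x,y)$. An *admissible control law* is a map $\mathbf u:[0,T]\times\mathbb R^n\to\mathbb R^k$ with $\mathbf u(t,x)\in U(t,x)$ for all $(t,x)$, such that for each initial point $(s,y)\in[0,T]\times\mathbb R^n$ the SDE $$dX_t=\mu(t,X_t,\mathbf u(t,X_t))\,dt+\sigma(t,X_t,\mathbf u(t,X_t))\,dW_t,\qquad X_s=y,$$ has a unique strong solution $X^{\mathbf u}$ on $[s,T]$. The reward functional is $$J(t,x,\mathbf u)=E_{t,x}\Big[\int_t^T H\big(t,x,s,X^{\mathbf u}_s,\mathbf u(s,X^{\mathbf u}_s)\big)\,ds+F(t,x,X^{\mathbf u}_T)\Big]+G\big(t,x,E_{t,x}[X^{\mathbf u}_T]\big),$$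 and it is assumed that for every $(t,x)\in[0,T]\times\mathbb R^n$ and every admissible $\mathbf u$, $$E_{t,x}\Big[\int_t^T|H(t,x,s,X^{\mathbf u}_s,\mathbf u(s,X^{\mathbf u}_s))|\,ds+|F(t,x,X^{\mathbf u}_T)|\Big]<\infty ,\qquad E_{t,x}\big[|X^{\mathbf u}_T|\big]<\infty .$$ For control laws $\hat{\mathbf u},\mathbf u$, a time $t$ and $h>0$, let $\mathbf u_h(s,y)=\mathbf u(s,y)$ for $t\le s<t+h$ and $\mathbf u_h(s,y)=\hat{\mathbf u}(s,y)$ for $t+h\le s\le T$. Given a reward functional $K$ (here $J$, or a rescaling of it as below), an admissible law $\hat{\mathbf u}$ is an *equilibrium control law for $K$* if for every admissible $\mathbf u$ and every $(t,x)\in[0,T]\times\mathbb R^n$, for all small $h>0$ the SDE under $\mathbf u_h$ started from $(t,x)$ has a unique strong solution satisfying the integrability conditions above (so that the reward of $\mathbf u_h$ is well defined), and $$\liminf_{h\downarrow0}\frac{K(t,x,\hat{\mathbf u})-K(t,x,\mathbf u_h)}{h}\ge 0 .$$ The corresponding *equilibrium value function* is $(t,x)\mapsto K(t,x,\hat{\mathbf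 u})$. **Proposition 7.1.** Let $\varphi:\mathbb R^n\to(0,\infty)$ be any function and put $J_\varphi(t,x,\mathbf u)=\varphi(x)J(t,x,\mathbf u)$. Then $J_\varphi$ and $J$ have the same equilibrium control laws, that is, $\hat{\mathbf u}$ is an equilibrium control law for $J_\varphi$ if and only if it is one for $J$ ($\hat{\mathbf u}_\varphi=\hat{\mathbf u}$). Moreover, for every such $\hat{\mathbf u}$, the corresponding equilibrium value functions $V_\varphi$ for $J_\varphi$ and $V$ for $J$ satisfy $$V_\varphi(t,x)=\varphi(x)\,V(t,x)\qquad\text{for all }(t,x)\in[0,T]\times\mathbb R^n .$$ -/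

import Mathlib

open MeasureTheory ProbabilityTheory Filter Topology Set
open scoped NNReal ENNReal

noncomputable section

namespace EquilibriumControl

/-! ### Wiener processes, the Itô integral -/

/-- Lebesgue measure on the time axis `[0, ∞)`. -/
def leb : Measure ℝ≥0 := Measure.comap ((↑) : ℝ≥0 → ℝ) volume

/-- A `d`-dimensional Wiener process on the probability space `(Ω, P)`: the coordinates are
mutually independent (as processes) one-dimensional standard Brownian motions. -/
structure WienerProcess (d : ℕ) {Ω : Type*} [MeasurableSpace Ω] (P : Measure Ω) where
  /-- The process itself. -/
  W : ℝ≥0 → Ω → Fin d → ℝ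
  measurable : ∀ t, Measurable (W t)
  brownian : ∀ j, IsBrownianReal (fun t ω => W t ω j) P
  indep : iIndepFun (fun (j : Fin d) (ω : Ω) (t : ℝ≥0) => W t ω j) P

variable {Ω : Type*} [mΩ : MeasurableSpace Ω] {P : Measure Ω} {n d k : ℕ}

/-- The filtration generated by the Wiener process, augmented by the `P`-null events. -/
def WienerProcess.filtration (B : WienerProcess d P) : Filtration ℝ≥0 mΩ where
  seq t := (⨆ s, ⨆ _ : s ≤ t, MeasurableSpace.comap (B.W s) inferInstance) ⊔
    MeasurableSpace.generateFrom {A | MeasurableSet A ∧ P A = 0}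
  mono' := fun _ _ hst => sup_le_sup
    (biSup_mono fun _ hr => le_trans hr hst) le_rfl
  le' := fun _ => sup_le (iSup₂_le fun r _ => (B.measurable r).comap_le)
    (MeasurableSpace.generateFrom_le fun _ hA => hA.1)

/-- A simple matrix-valued integrand
`∑_{i < num} coef i · 1_{(time i, time (i+1)]}` with bounded coefficients, `coef i` being known
at time `time i`. -/
structure SimpleIntegrand (ℱ : Filtration ℝ≥0 mΩ) (n d : ℕ) where
  num : ℕ
  time : ℕ → ℝ≥0
  mono : Monotone time
  coef : ℕ → Ω → Matrix (Fin n) (Fin d) ℝ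
  adapted : ∀ m i j, Measurable[ℱ (time m)] (fun ω => coef m ω i j)
  bounded : ∃ C : ℝ, ∀ m ω i j, |coef m ω i j| ≤ C

/-- The matrix-valued process defined by a simple integrand. -/
def SimpleIntegrand.process {ℱ : Filtration ℝ≥0 mΩ} (η : SimpleIntegrand ℱ n d)
    (t : ℝ≥0) (ω : Ω) : Matrix (Fin n) (Fin d) ℝ :=
  ∑ m ∈ Finset.range η.num, if η.time m < t ∧ t ≤ η.time (m + 1) then η.coef m ω else 0

/-- The elementary stochastic integral `∫₀ᵗ η dW` of a simple integrand. -/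
def SimpleIntegrand.integral {ℱ : Filtration ℝ≥0 mΩ} (η : SimpleIntegrand ℱ n d)
    (W : ℝ≥0 → Ω → Fin d → ℝ) (t : ℝ≥0) (ω : Ω) : Fin n → ℝ :=
  ∑ m ∈ Finset.range η.num,
    (η.coef m ω).mulVec (W (min (η.time (m + 1)) t) ω - W (min (η.time m) t) ω)

/-- The squared Frobenius norm of a matrix. -/
def frobSq (A : Matrix (Fin n) (Fin d) ℝ) : ℝ := ∑ i, ∑ j, A i j ^ 2

/-- `IsItoIntegral B T S I`: on `[0, T]` the process `I` is the Itô integral `I_t = ∫₀ᵗ S dW` of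
the progressively measurable integrand `S`, which satisfies `∫₀ᵀ |S|² dr < ∞` almost surely.
That is, there are simple integrands `η m` with `∫₀ᵀ |η m - S|² dr → 0` in probability and
`sup_{t ≤ T} |∫₀ᵗ η m dW - I_t| → 0` in probability. This determines `I` on `[0, T]` up to
indistinguishability. -/
structure IsItoIntegral (B : WienerProcess d P) (T : ℝ≥0)
    (S : ℝ≥0 → Ω → Matrix (Fin n) (Fin d) ℝ) (I : ℝ≥0 → Ω → Fin n → ℝ) : Prop where
  progressive : ∀ i j, IsProgressive B.filtration (fun t ω => S t ω i j)
  sq_integrable : ∀ᵐ ω ∂P, ∫⁻ r in Icc 0 T, ENNReal.ofReal (frobSq (S r ω)) ∂leb < ∞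
  approx : ∃ η : ℕ → SimpleIntegrand B.filtration n d,
    (∀ ε : ℝ≥0∞, 0 < ε → Tendsto (fun m => P {ω | ε ≤
        ∫⁻ r in Icc 0 T, ENNReal.ofReal (frobSq ((η m).process r ω - S r ω)) ∂leb}) atTop (𝓝 0)) ∧
    (∀ ε : ℝ, 0 < ε → Tendsto (fun m => P {ω | ∃ t ≤ T,
        ε ≤ ‖(η m).integral B.W t ω - I t ω‖}) atTop (𝓝 0))

/-! ### The controlled stochastic differential equation -/

/-- The exogenous data on the time interval `[0, T]`, for an `n`-dimensional state, a
`d`-dimensional Wiener process and a `k`-dimensional control. -/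
structure ControlProblem (n d k : ℕ) where
  /-- The time horizon. -/
  T : ℝ≥0
  T_pos : 0 < T
  /-- The drift `μ(t, x, u)`. -/
  μ : ℝ≥0 → (Fin n → ℝ) → (Fin k → ℝ) → (Fin n → ℝ)
  /-- The diffusion coefficient `σ(t, x, u)`. -/
  σ : ℝ≥0 → (Fin n → ℝ) → (Fin k → ℝ) → Matrix (Fin n) (Fin d) ℝ
  /-- The control constraint `U(t, x)`. -/
  U : ℝ≥0 → (Fin n → ℝ) → Set (Fin k → ℝ)
  /-- The running reward `H(t, x, s, y, u)`. -/
  H : ℝ≥0 → (Fin n → ℝ) → ℝ≥0 → (Fin n → ℝ) → (Fin k → ℝ) → ℝ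
  /-- The terminal reward `F(t, x, y)`. -/
  F : ℝ≥0 → (Fin n → ℝ) → (Fin n → ℝ) → ℝ
  /-- The function `G(t, x, y)` applied to the expected terminal state. -/
  G : ℝ≥0 → (Fin n → ℝ) → (Fin n → ℝ) → ℝ

/-- A feedback control law `u(t, x)`; only its values for `t ∈ [0, T]` matter. -/
abbrev ControlLaw (n k : ℕ) := ℝ≥0 → (Fin n → ℝ) → (Fin k → ℝ)

/-- A reward functional `J(t, x, u)`. -/
abbrev RewardFunctional (n k : ℕ) := ℝ≥0 → (Fin n → ℝ) → ControlLaw n k → ℝ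

namespace ControlProblem

variable (M : ControlProblem n d k) (B : WienerProcess d P)

/-- `X` is a strong solution on `[s, T]`, relative to the given Wiener process and its augmented
filtration, of `dX_t = μ(t, X_t, u(t, X_t)) dt + σ(t, X_t, u(t, X_t)) dW_t`, `X_s = y`. -/
structure IsStrongSolution (u : ControlLaw n k) (s : ℝ≥0) (y : Fin n → ℝ)
    (X : ℝ≥0 → Ω → Fin n → ℝ) : Prop where
  adapted : ∀ r ∈ Icc s M.T, Measurable[B.filtration r] (X r)
  continuous : ∀ᵐ ω ∂P, ContinuousOn (fun r => X r ω) (Icc s M.T)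
  drift_progressive : IsProgressive B.filtration (fun r ω =>
    if s < r ∧ r ≤ M.T then M.μ r (X r ω) (u r (X r ω)) else 0)
  drift_integrable : ∀ᵐ ω ∂P,
    IntegrableOn (fun r => M.μ r (X r ω) (u r (X r ω))) (Ioc s M.T) leb
  equation : ∃ I : ℝ≥0 → Ω → Fin n → ℝ,
    IsItoIntegral B M.T (fun r ω =>
      if s < r ∧ r ≤ M.T then M.σ r (X r ω) (u r (X r ω)) else 0) I ∧
    ∀ᵐ ω ∂P, ∀ r ∈ Icc s M.T,
      X r ω = y + (∫ q in Ioc s r, M.μ q (X q ω) (u q (X q ω)) ∂leb) + I r ω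

/-- The state equation under `u` started from `(s, y)` has a strong solution, and any two strong
solutions are indistinguishable on `[s, T]`. -/
def HasUniqueStrongSolution (u : ControlLaw n k) (s : ℝ≥0) (y : Fin n → ℝ) : Prop :=
  (∃ X, M.IsStrongSolution B u s y X) ∧
  ∀ X Y, M.IsStrongSolution B u s y X → M.IsStrongSolution B u s y Y →
    ∀ᵐ ω ∂P, ∀ r ∈ Icc s M.T, X r ω = Y r ω

/-- Admissible control laws. -/
structure Admissible (u : ControlLaw n k) : Prop where
  mem : ∀ t ≤ M.T, ∀ x, u t x ∈ M.U t x
  solvable : ∀ s ≤ M.T, ∀ y, M.HasUniqueStrongSolution B u s y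

open Classical in
/-- The state process `X^u` started from `(s, y)` (the value is irrelevant if the state equation
has no strong solution). -/
def state (u : ControlLaw n k) (s : ℝ≥0) (y : Fin n → ℝ) : ℝ≥0 → Ω → Fin n → ℝ :=
  if h : ∃ X, M.IsStrongSolution B u s y X then h.choose else fun _ _ => y

/-- The reward functional
`J(t, x, u) = E_{t,x}[∫_t^T H(t, x, s, X_s, u_s(X_s)) ds + F(t, x, X_T)] + G(t, x, E_{t,x}[X_T])`. -/
def reward : RewardFunctional n k := fun t x u =>
  (∫ ω, ((∫ s in Ioc t M.T, M.H t x s (M.state B u t x s ω) (u s (M.state B u t x s ω)) ∂leb)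
      + M.F t x (M.state B u t x M.T ω)) ∂P)
    + M.G t x (∫ ω, M.state B u t x M.T ω ∂P)

/-- The law `u` generates a unique state process from `(t, x)`, and
`E_{t,x}[∫_t^T |H(t, x, s, X_s, u_s(X_s))| ds + |F(t, x, X_T)|] < ∞` and
`E_{t,x}[|X_T|] < ∞`. -/
structure RewardDefined (t : ℝ≥0) (x : Fin n → ℝ) (u : ControlLaw n k) : Prop where
  solvable : M.HasUniqueStrongSolution B u t x
  running : Integrable (fun p : Ω × ℝ≥0 =>
    M.H t x p.2 (M.state B u t x p.2 p.1) (u p.2 (M.state B u t x p.2 p.1)))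
    (P.prod (leb.restrict (Ioc t M.T)))
  terminal : Integrable (fun ω => M.F t x (M.state B u t x M.T ω)) P
  final_state : Integrable (fun ω => M.state B u t x M.T ω) P

/-- The standing integrability assumption. -/
def IntegrabilityAssumption : Prop :=
  ∀ u, M.Admissible B u → ∀ t ≤ M.T, ∀ x, M.RewardDefined B t x u

/-- The perturbed law `u_h`, equal to `u` on `[t, t + h)` and to `û` otherwise
(started at time `t`, only times `≥ t` matter). -/
def perturb (uhat u : ControlLaw n k) (t h : ℝ≥0) : ControlLaw n k := fun s y =>
  if t ≤ s ∧ s < t + h then u s y else uhat s y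

/-- `û` is an equilibrium control law for the reward functional `J`: it is admissible, and for
every admissible `u` and every initial point `(t, x)`
`liminf_{h ↓ 0} (J(t, x, û) - J(t, x, u_h)) / h ≥ 0` (as an extended real number), where the
perturbed laws `u_h` are required to generate a well-defined reward for all small `h > 0`. -/
structure IsEquilibrium (J : RewardFunctional n k) (uhat : ControlLaw n k) : Prop where
  admissible : M.Admissible B uhat
  perturb_defined : ∀ u, M.Admissible B u → ∀ t ≤ M.T, ∀ x,
    ∀ᶠ h in 𝓝[>] (0 : ℝ≥0), M.RewardDefined B t x (perturb uhat u t h)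
  liminf_nonneg : ∀ u, M.Admissible B u → ∀ t ≤ M.T, ∀ x,
    0 ≤ liminf (fun h : ℝ≥0 =>
      (((J t x uhat - J t x (perturb uhat u t h)) / (h : ℝ) : ℝ) : EReal)) (𝓝[>] (0 : ℝ≥0))

/-- `û` is an equilibrium control law for `J` and `V(t, x) = J(t, x, û)`, for `t ∈ [0, T]`, is the
corresponding equilibrium value function. -/
structure IsEquilibriumPair (J : RewardFunctional n k) (uhat : ControlLaw n k)
    (V : ℝ≥0 → (Fin n → ℝ) → ℝ) : Prop where
  equilibrium : M.IsEquilibrium B J uhat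
  value : ∀ t ≤ M.T, ∀ x, V t x = J t x uhat

end ControlProblem

/-- The rescaled reward functional `J_φ(t, x, u) = φ(x) J(t, x, u)`. -/
def scaleReward (φ : (Fin n → ℝ) → ℝ) (J : RewardFunctional n k) : RewardFunctional n k :=
  fun t x u => φ x * J t x u

end EquilibriumControl

end

-- The equilibrium condition at `(t, x)` compares rewards from that one initial point, so `φ x` is a
-- positive constant in the whole limit `h ↓ 0`: rescaling multiplies each difference quotient by
-- it, and this preserves the sign of the lower limit (`EReal.zero_le_liminf_coe_const_mul_iff`). No
-- regularity of `φ` is needed, and nothing about the dynamics enters. Once the equilibrium laws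
-- agree, the value function identity is the definition of `J_φ` evaluated at the common law.

open Filter in
/-- Whether the lower limit, in the extended reals, of a real function is nonnegative can be tested
on negative real bounds. -/
theorem EReal.zero_le_liminf_coe_iff {α : Type*} {l : Filter α} {f : α → ℝ} :
    0 ≤ liminf (fun a => (f a : EReal)) l ↔ ∀ y < 0, ∀ᶠ a in l, y < f a := by
  rw [le_liminf_iff]
  constructor
  · intro h y hy
    exact (h y (by exact_mod_cast hy)).mono fun a ha => by exact_mod_cast ha
  · intro h y hy
    -- Here `y` is an extended real, possibly `⊥`; a real `z` strictly between `y` and `0` brings it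
    -- within reach of the hypothesis.
    obtain ⟨z, hyz, hz⟩ := EReal.lt_iff_exists_real_btwn.1 hy
    exact (h z (by exact_mod_cast hz)).mono fun a ha => hyz.trans (by exact_mod_cast ha)

open Filter in
/-- Nonnegativity of a lower limit is invariant under multiplication by a positive constant. -/
theorem EReal.zero_le_liminf_coe_const_mul_iff {α : Type*} {l : Filter α} {f : α → ℝ} {c : ℝ}
    (hc : 0 < c) :
    0 ≤ liminf (fun a => ((c * f a : ℝ) : EReal)) l ↔ 0 ≤ liminf (fun a => (f a : EReal)) l := by
  simp only [EReal.zero_le_liminf_coe_iff]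
  constructor
  · intro h y hy
    -- Scaling by `c` permutes the negative reals, so the bound `y` for `f` is the bound `c * y` for
    -- `c * f`.
    exact (h (c * y) (mul_neg_of_pos_of_neg hc hy)).mono fun a ha => lt_of_mul_lt_mul_left ha hc.le
  · intro h y hy
    exact (h (y / c) (div_neg_of_neg_of_pos hy hc)).mono fun a ha => (div_lt_iff₀' hc).1 ha

namespace EquilibriumControl

/-- A reward functional and its rescaling by a positive function of the initial state have the same
equilibrium control laws. -/
theorem ControlProblem.isEquilibrium_scaleReward_iff {n d k : ℕ} {Ω : Type*} [MeasurableSpace Ω]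
    {P : MeasureTheory.Measure Ω} (M : ControlProblem n d k) (B : WienerProcess d P)
    {φ : (Fin n → ℝ) → ℝ} (hφ : ∀ x, 0 < φ x) (J : RewardFunctional n k)
    (uhat : ControlLaw n k) :
    M.IsEquilibrium B (scaleReward φ J) uhat ↔ M.IsEquilibrium B J uhat := by
  have key (u : ControlLaw n k) (t : NNReal) (x : Fin n → ℝ) :=
    EReal.zero_le_liminf_coe_const_mul_iff (l := nhdsWithin (0 : NNReal) (Set.Ioi 0))
      (f := fun h : NNReal => (J t x uhat - J t x (perturb uhat u t h)) / (h : ℝ)) (hφ x)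
  -- Moves `φ x` inside the quotient and distributes it over the difference, which gives the
  -- difference quotient of `scaleReward φ J` up to unfolding.
  simp only [← mul_div_assoc, mul_sub] at key
  constructor
  · intro h
    -- Admissibility and well-posedness of the perturbed laws do not involve the reward functional
    -- `J`, so they carry over unchanged.
    exact ⟨h.admissible, h.perturb_defined, fun u hu t ht x =>
      (key u t x).1 (h.liminf_nonneg u hu t ht x)⟩
  · intro h
    exact ⟨h.admissible, h.perturb_defined, fun u hu t ht x =>
      (key u t x).2 (h.liminf_nonneg u hu t ht x)⟩

end EquilibriumControl

open EquilibriumControl in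
theorem proposition7p1 {n d k : ℕ} {Ω : Type*} [MeasurableSpace Ω] (P : Measure Ω)
    [IsProbabilityMeasure P] (B : WienerProcess d P) (M : ControlProblem n d k)
    (hint : M.IntegrabilityAssumption B)
    (φ : (Fin n → ℝ) → ℝ) (hφ : ∀ x, 0 < φ x) :
    -- the equilibrium control laws for `J_φ` and for `J` are the same
    (∀ uhat : ControlLaw n k,
      M.IsEquilibrium B (scaleReward φ (M.reward B)) uhat ↔
        M.IsEquilibrium B (M.reward B) uhat) ∧
    -- and the corresponding equilibrium value functions satisfy `V_φ(t, x) = φ(x) V(t, x)`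
    (∀ (uhat : ControlLaw n k) (V Vφ : ℝ≥0 → (Fin n → ℝ) → ℝ),
      M.IsEquilibriumPair B (M.reward B) uhat V →
      M.IsEquilibriumPair B (scaleReward φ (M.reward B)) uhat Vφ →
      ∀ t ≤ M.T, ∀ x, Vφ t x = φ x * V t x) := by
  refine ⟨M.isEquilibrium_scaleReward_iff B hφ (M.reward B), fun uhat V Vφ hV hVφ t ht x => ?_⟩
  rw [hVφ.value t ht x, hV.value t ht x, scaleReward]
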